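/- Two teams $A,B$ compete in $2N+1$ battles $t=1,\dots,2N+1$ ($N\ge 0$ an integer); the team that wins at least $N+1$ battles wins the contest. In battle $t$ the two matched players have marginal effort costs $c_{At},c_{Bt}>0$, and $r_t\in(0,1]$ is the discriminatory power of the battle. First, the managers simultaneously choose prize divisions $\mathbf v_i\in\Delta_i=\{\mathbf v\ge 0:\sum_t v_t=W_i\}$, where $W_i>0$ ($i\in\{A,B\}$), each maximizing the probability that her team wins the contest. Then the battles are played one after the other, the divisions and all earlier outcomes being observed: in battle $t$ the players simultaneously choose efforts $e_{At},e_{Bt}\ge 0$, player $A(t)$ wins with probability $e_{At}^{r_t}/(e_{At}^{r_t}+e_{Bt}^{r_t})$ ($1/2$ if both efforts are $0$), and player $i(t)$ pays $c_{it}e_{it}$ and receives $v_{it}$ if and only if team $i$ wins the contest. The players are risk neutral and play a pure-strategy Nash equilibrium in every battle after every history; if exactly one of the prizes $v_{At},v_{Bt}$ is zero and winning the battle raises a team's probability of winning the contest, no such equilibrium exists, and the player with the positive prize is taken to win the battle with certainty. In reduced form, battle $t$ is won by $A$ with probability $$p_{At}=\frac{(v_{At}/c_{At})^{r_t}}{(v_{At}/c_{At})^{r_t}+(v_{Bt}/c_{Bt})^{r_t}}\qquad(\tfrac12\text{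 if }v_{At}=v_{Bt}=0),$$ by $B$ with probability $p_{Bt}=1-p_{At}$, independently across battles, and the managers play the game on $\Delta_A\times\Delta_B$ with payoffs $$\mathrm{Prob}_i(\mathbf v_A,\mathbf v_B)=\sum_{|w|\ge N+1}\ \prod_{t\in w}p_{it}\prod_{q\notin w}p_{jq},\qquad \{i,j\}=\{A,B\}.$$ Let $k=W_B/W_A$ and $c_t=(c_{Bt}/c_{At})^{r_t}$. Suppose that $c_t=k^{r_t}$ for every battle $t$. Then the managers' reduced-form game has exactly one pure-strategy Nash equilibrium, namely $$v_{it}^*=W_i\cdot\frac{r_t}{\sum_{\tau}r_\tau},\qquad i\in\{A,B\},\ t=1,\dots,2N+1,$$ and every battle is effectively balanced in it: $p_{At}=p_{Bt}=\tfrac12$ for all $t$. Likewise in the underlying two-stage game: equilibrium play of the battles exists after every pair of prize divisions, and, whichever such play the managers anticipate, $(\mathbf v_A^*,\mathbf v_B^*)$ is the unique pure-strategy Nash equilibrium between the managers. In particular the equilibrium budget shares $v_{it}^*/W_i$ are the same for both teams and depend only on the discriminatory powers. -/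

import Mathlib

/-- `(a, b)` is a pure-strategy Nash equilibrium of the two-player game with strategy sets
`SA`, `SB` and payoffs `UA`, `UB`. -/
def IsNash {α β : Type} (SA : Set α) (SB : Set β) (UA UB : α → β → ℝ) (a : α) (b : β) : Prop :=
  a ∈ SA ∧ b ∈ SB ∧ (∀ a' ∈ SA, UA a' b ≤ UA a b) ∧ (∀ b' ∈ SB, UB a b' ≤ UB a b)

/-- The primitives of a contest of `2N+1` battles between teams `A` and `B`: marginal effort
costs, discriminatory powers and team prizes. -/
structure TeamContest (N : ℕ) where
  cA : Fin (2 * N + 1) → ℝ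
  cB : Fin (2 * N + 1) → ℝ
  r : Fin (2 * N + 1) → ℝ
  WA : ℝ
  WB : ℝ
  cA_pos : ∀ t, 0 < cA t
  cB_pos : ∀ t, 0 < cB t
  r_pos : ∀ t, 0 < r t
  r_le_one : ∀ t, r t ≤ 1
  WA_pos : 0 < WA
  WB_pos : 0 < WB

/-- The divisions of a prize `W` among the `2N+1` members of a team. -/
def prizeDivisions (N : ℕ) (W : ℝ) : Set (Fin (2 * N + 1) → ℝ) :=
  {v | (∀ t, 0 ≤ v t) ∧ ∑ t, v t = W}

/-- The Tullock contest success function: the probability that the player with effort `eA` wins. -/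
noncomputable def tullock (r eA eB : ℝ) : ℝ :=
  if eA = 0 ∧ eB = 0 then 1 / 2 else eA ^ r / (eA ^ r + eB ^ r)

/-- `IsBattleOutcome r cA cB vA vB V1 V0 p`: `p` is the probability that team `A`'s player wins a
battle in equilibrium, when team `A` wins the contest with probability `V1` after a victory and
`V0` after a defeat in this battle. A player receives the prize `vA` (resp. `vB`) if his team wins
the contest, and pays for his effort. If exactly one of the two prizes is zero and the battle
matters, there is no equilibrium in efforts (the incentivized player wants to exert an arbitrarily
small positive effort); by convention this player then wins with certainty. -/
def IsBattleOutcome (r cA cB vA vB V1 V0 p : ℝ) : Prop :=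
  (∃ eA eB : ℝ,
    IsNash (Set.Ici 0) (Set.Ici 0)
      (fun x y => vA * (tullock r x y * V1 + (1 - tullock r x y) * V0) - cA * x)
      (fun x y => vB * (1 - (tullock r x y * V1 + (1 - tullock r x y) * V0)) - cB * y)
      eA eB ∧
    p = tullock r eA eB) ∨
  (V0 < V1 ∧ vA = 0 ∧ 0 < vB ∧ p = 0) ∨
  (V0 < V1 ∧ 0 < vA ∧ vB = 0 ∧ p = 1)

/-- The battles are played in the order of their indices. `q t w` is the probability that team `A`
wins battle `t` when `w` is the set of the earlier battles that team `A` has won.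
`contestWinProb q m w` is the probability that team `A` wins the contest (at least `N+1` battles)
when the last `m` battles are still to be played and team `A` has won the battles in `w`. -/
noncomputable def contestWinProb {N : ℕ}
    (q : Fin (2 * N + 1) → Finset (Fin (2 * N + 1)) → ℝ) :
    ℕ → Finset (Fin (2 * N + 1)) → ℝ
  | 0, w => if N + 1 ≤ w.card then 1 else 0
  | m + 1, w =>
      q ⟨2 * N - m, by omega⟩ w * contestWinProb q m (insert ⟨2 * N - m, by omega⟩ w) +
        (1 - q ⟨2 * N - m, by omega⟩ w) * contestWinProb q m w

namespace TeamContest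

variable {N : ℕ}

/-- Given the divisions `vA`, `vB`, the play described by `q` is in equilibrium in every battle
after every history of outcomes. -/
def IsContinuation (C : TeamContest N) (vA vB : Fin (2 * N + 1) → ℝ)
    (q : Fin (2 * N + 1) → Finset (Fin (2 * N + 1)) → ℝ) : Prop :=
  ∀ t : Fin (2 * N + 1), ∀ w : Finset (Fin (2 * N + 1)), (∀ s ∈ w, s < t) →
    IsBattleOutcome (C.r t) (C.cA t) (C.cB t) (vA t) (vB t)
      (contestWinProb q (2 * N - t.val) (insert t w)) (contestWinProb q (2 * N - t.val) w) (q t w)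

/-- `Q` prescribes equilibrium play of the battles after every pair of divisions. -/
def IsPlay (C : TeamContest N)
    (Q : (Fin (2 * N + 1) → ℝ) → (Fin (2 * N + 1) → ℝ) →
      Fin (2 * N + 1) → Finset (Fin (2 * N + 1)) → ℝ) : Prop :=
  ∀ vA ∈ prizeDivisions N C.WA, ∀ vB ∈ prizeDivisions N C.WB, C.IsContinuation vA vB (Q vA vB)

/-- The managers' choices `vA`, `vB` are optimal against each other, when the battles are then
played according to `Q` and each manager maximizes the probability that her team wins. -/
def IsManagersEquilibrium (C : TeamContest N)
    (Q : (Fin (2 * N + 1) → ℝ) → (Fin (2 * N + 1) → ℝ) →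
      Fin (2 * N + 1) → Finset (Fin (2 * N + 1)) → ℝ)
    (vA vB : Fin (2 * N + 1) → ℝ) : Prop :=
  IsNash (prizeDivisions N C.WA) (prizeDivisions N C.WB)
    (fun x y => contestWinProb (Q x y) (2 * N + 1) ∅)
    (fun x y => 1 - contestWinProb (Q x y) (2 * N + 1) ∅) vA vB

/-- The reduced-form probability that team `A` wins battle `t`. -/
noncomputable def pA (C : TeamContest N) (vA vB : Fin (2 * N + 1) → ℝ) (t : Fin (2 * N + 1)) : ℝ :=
  if vA t = 0 ∧ vB t = 0 then 1 / 2
  else (vA t / C.cA t) ^ C.r t / ((vA t / C.cA t) ^ C.r t + (vB t / C.cB t) ^ C.r t)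

/-- The reduced-form probability that team `B` wins battle `t`. -/
noncomputable def pB (C : TeamContest N) (vA vB : Fin (2 * N + 1) → ℝ) (t : Fin (2 * N + 1)) : ℝ :=
  1 - C.pA vA vB t

/-- The reduced-form probability that team `A` wins at least `N+1` of the independent battles. -/
noncomputable def probA (C : TeamContest N) (vA vB : Fin (2 * N + 1) → ℝ) : ℝ :=
  ∑ w : Finset (Fin (2 * N + 1)) with N + 1 ≤ w.card,
    (∏ t ∈ w, C.pA vA vB t) * ∏ t ∈ wᶜ, C.pB vA vB t

/-- The reduced-form probability that team `B` wins at least `N+1` of the independent battles. -/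
noncomputable def probB (C : TeamContest N) (vA vB : Fin (2 * N + 1) → ℝ) : ℝ :=
  ∑ w : Finset (Fin (2 * N + 1)) with N + 1 ≤ w.card,
    (∏ t ∈ w, C.pB vA vB t) * ∏ t ∈ wᶜ, C.pA vA vB t

/-- Pure-strategy Nash equilibrium of the managers' reduced-form game. -/
def IsReducedEquilibrium (C : TeamContest N) (vA vB : Fin (2 * N + 1) → ℝ) : Prop :=
  IsNash (prizeDivisions N C.WA) (prizeDivisions N C.WB) C.probA C.probB vA vB

end TeamContest

/-! Against a rival who divides proportionally, the balance condition turns the odds in battle t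
into x_t = (v_t/v*_t)^{r_t}, with v* the proportional division. As r_t ≤ 1, Bernoulli's inequality
gives x_t ≤ 1 + R v_t/W - r_t, where R is the sum of the powers; these bounds add up to 2N+1, so the
mean odds are at most one (`sum_rpow_div_le`). Exactly k battles are won with probability
e_k(x)/∏(1+x_t). When the mean is at most one, e_k divided by its binomial coefficient is
nonincreasing in k, so e_{2N+1-k} ≤ e_k for k ≤ N, strictly at k = 0 unless every x_t is 1. Any
other division therefore wins with probability below 1/2 (`majorityProb_lt_half`). The managers'
game has constant sum, and this strictness on both sides yields existence and uniqueness.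

In the two-stage game the stake V1 - V0 of a battle multiplies both prizes, while the Tullock
function is homogeneous of degree zero: a battle that matters has its reduced-form outcome whatever
the stake (`isBattleOutcome_iff`), and one that does not matter cannot change the contest
probability. Backward induction (`contestWinProb_congr`) identifies the managers' payoffs with the
reduced form. -/

/-! ### Elementary symmetric sums and their decay when the mean is at most one -/

/-- The elementary symmetric function of degree `k` of the values of `x` on `s`. -/
noncomputable def symmSum {ι : Type*} (x : ι → ℝ) (s : Finset ι) (k : ℕ) : ℝ :=
  ∑ T ∈ Finset.powersetCard k s, ∏ t ∈ T, x t

section SymmSum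

variable {ι : Type*} (x : ι → ℝ)

theorem symmSum_zero (s : Finset ι) : symmSum x s 0 = 1 := by
  simp [symmSum]

theorem symmSum_card (s : Finset ι) : symmSum x s s.card = ∏ t ∈ s, x t := by
  simp [symmSum]

theorem symmSum_nonneg (hx : ∀ i, 0 ≤ x i) (s : Finset ι) (k : ℕ) : 0 ≤ symmSum x s k :=
  Finset.sum_nonneg fun _ _ => Finset.prod_nonneg fun i _ => hx i

theorem symmSum_eq_zero {s : Finset ι} {k : ℕ} (h : s.card < k) : symmSum x s k = 0 := by
  rw [symmSum, Finset.powersetCard_eq_empty.2 h, Finset.sum_empty]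

/-- A strict AM-GM inequality, from x ≤ exp(x - 1) with equality only at x = 1. A zero factor is
treated apart because the strict comparison of products needs positive factors. -/
theorem prod_lt_one_of_sum_le (hx : ∀ i, 0 ≤ x i) {s : Finset ι} (hs : ∑ i ∈ s, x i ≤ s.card)
    (hne : ∃ i ∈ s, x i ≠ 1) : ∏ i ∈ s, x i < 1 := by
  by_cases h0 : ∃ i ∈ s, x i = 0
  · obtain ⟨i, hi, h⟩ := h0
    rw [Finset.prod_eq_zero hi h]
    exact one_pos
  · push Not at h0
    calc ∏ i ∈ s, x i < ∏ i ∈ s, Real.exp (x i - 1) := by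
          refine Finset.prod_lt_prod (fun i hi => (hx i).lt_of_ne' (h0 i hi)) (fun i _ => ?_) ?_
          · have := Real.add_one_le_exp (x i - 1)
            linarith
          · obtain ⟨i, hi, h⟩ := hne
            have := Real.add_one_lt_exp (sub_ne_zero.2 h)
            exact ⟨i, hi, by linarith⟩
      _ = Real.exp (∑ i ∈ s, (x i - 1)) := (Real.exp_sum _ _).symm
      _ ≤ 1 := by
          rw [Real.exp_le_one_iff]
          simp
          exact hs

variable [DecidableEq ι]

theorem symmSum_insert_succ {a : ι} {s : Finset ι} (ha : a ∉ s) (k : ℕ) :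
    symmSum x (insert a s) (k + 1) = symmSum x s (k + 1) + x a * symmSum x s k := by
  have hmem : ∀ T ∈ Finset.powersetCard k s, a ∉ T := fun T hT h =>
    ha ((Finset.mem_powersetCard.1 hT).1 h)
  unfold symmSum
  rw [← Nat.succ_eq_add_one, Finset.powersetCard_succ_insert ha, Finset.sum_union,
    Finset.sum_image, Finset.mul_sum]
  · congr 1
    exact Finset.sum_congr rfl fun T hT => Finset.prod_insert (hmem T hT)
  · intro T hT T' hT' h
    rw [← Finset.erase_insert (hmem T hT), ← Finset.erase_insert (hmem T' hT')]
    exact congrArg (fun S => Finset.erase S a) h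
  · rw [Finset.disjoint_left]
    intro T hT hT'
    obtain ⟨S, -, rfl⟩ := Finset.mem_image.1 hT'
    exact ha ((Finset.mem_powersetCard.1 hT).1 (Finset.mem_insert_self a S))

theorem sum_erase_insert {a : ι} {s : Finset ι} (ha : a ∉ s) (k : ℕ) (g : ι → ℝ) :
    ∑ i ∈ insert a s, g i * symmSum x ((insert a s).erase i) k =
      g a * symmSum x s k + ∑ i ∈ s, g i * symmSum x (insert a (s.erase i)) k := by
  rw [Finset.sum_insert ha, Finset.erase_insert ha]
  congr 1
  refine Finset.sum_congr rfl fun i hi => ?_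
  rw [Finset.erase_insert_of_ne]
  rintro rfl
  exact ha hi

/-- The recursion behind the next two double counts; the weight `g` is `x` in one and constantly 1
in the other. -/
theorem sum_erase_insert_succ {a : ι} {s : Finset ι} (ha : a ∉ s) (k : ℕ) (g : ι → ℝ) :
    ∑ i ∈ insert a s, g i * symmSum x ((insert a s).erase i) (k + 1) =
      g a * symmSum x s (k + 1) + ∑ i ∈ s, g i * symmSum x (s.erase i) (k + 1) +
        x a * ∑ i ∈ s, g i * symmSum x (s.erase i) k := by
  rw [sum_erase_insert x ha, Finset.mul_sum, add_assoc, ← Finset.sum_add_distrib]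
  congr 1
  refine Finset.sum_congr rfl fun i _ => ?_
  rw [symmSum_insert_succ x fun h => ha (Finset.mem_of_mem_erase h)]
  ring

/-- Double counting: each (k+1)-subset arises once for each of its elements i. -/
theorem sum_mul_symmSum_erase (s : Finset ι) (k : ℕ) :
    ∑ i ∈ s, x i * symmSum x (s.erase i) k = (k + 1) * symmSum x s (k + 1) := by
  induction s using Finset.induction_on generalizing k with
  | empty => simp [symmSum_eq_zero x (s := ∅) (k := k + 1) (by simp)]
  | insert a s ha ih =>
    cases k with
    | zero =>
      have h := ih 0
      simp only [symmSum_zero, mul_one] at h ⊢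
      rw [Finset.sum_insert ha, h, symmSum_insert_succ x ha, symmSum_zero]
      push_cast
      ring
    | succ k =>
      rw [sum_erase_insert_succ x ha, ih, ih, symmSum_insert_succ x ha]
      push_cast
      ring

/-- Double counting: each k-subset avoids `s.card - k` elements. The subtraction is real; for k >
`s.card` both sides vanish. -/
theorem sum_symmSum_erase (s : Finset ι) (k : ℕ) :
    ∑ i ∈ s, symmSum x (s.erase i) k = (s.card - k) * symmSum x s k := by
  induction s using Finset.induction_on generalizing k with
  | empty =>
    cases k with
    | zero => simp
    | succ k => simp [symmSum_eq_zero x (s := ∅) (k := k + 1) (by simp)]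
  | insert a s ha ih =>
    cases k with
    | zero => simp [symmSum_zero]
    | succ k =>
      have h := sum_erase_insert_succ x ha k (fun _ => 1)
      simp only [one_mul] at h
      rw [h, ih, ih, symmSum_insert_succ x ha, Finset.card_insert_of_notMem ha]
      push_cast
      ring

/-- Both sets consist of s without i and j plus one more element, and the sum is increasing in the
value of that element. -/
theorem symmSum_erase_le (hx : ∀ i, 0 ≤ x i) {s : Finset ι} {i j : ι} (hi : i ∈ s) (hj : j ∈ s)
    (hij : x j ≤ x i) (k : ℕ) : symmSum x (s.erase i) k ≤ symmSum x (s.erase j) k := by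
  rcases eq_or_ne i j with rfl | hne
  · rfl
  cases k with
  | zero => simp [symmSum_zero]
  | succ k =>
    have h1 : s.erase i = insert j ((s.erase i).erase j) :=
      (Finset.insert_erase (Finset.mem_erase.2 ⟨hne.symm, hj⟩)).symm
    have h2 : s.erase j = insert i ((s.erase i).erase j) := by
      rw [Finset.erase_right_comm]
      exact (Finset.insert_erase (Finset.mem_erase.2 ⟨hne, hi⟩)).symm
    rw [h1, h2, symmSum_insert_succ x (by simp), symmSum_insert_succ x (by simp)]
    gcongr
    exact symmSum_nonneg x hx _ _

/-- If the mean of the nonnegative `x` is at most one, the normalized elementary symmetric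
functions decrease with the degree. -/
theorem succ_mul_symmSum_succ_le (hx : ∀ i, 0 ≤ x i) {s : Finset ι}
    (hs : ∑ i ∈ s, x i ≤ s.card) (k : ℕ) :
    (k + 1) * symmSum x s (k + 1) ≤ (s.card - k) * symmSum x s k := by
  -- Small x_i means both a large 1 - x_i and a large e_k without i. Chebyshev's sum inequality then
  -- bounds the sum of their products below by a multiple of ∑(1 - x_i), which is nonnegative.
  have hmono : MonovaryOn (fun i => 1 - x i) (fun i => symmSum x (s.erase i) k) s := by
    intro i hi j hj hlt
    by_contra hcon
    have : x i ≤ x j := by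
      simp only [not_le] at hcon
      linarith
    exact absurd (symmSum_erase_le x hx hj hi this k) (not_le.2 hlt)
  have hcheb := hmono.sum_mul_sum_le_card_mul_sum
  have hpos : 0 ≤ (∑ i ∈ s, (1 - x i)) * ∑ i ∈ s, symmSum x (s.erase i) k := by
    refine mul_nonneg ?_ (Finset.sum_nonneg fun i _ => symmSum_nonneg x hx _ _)
    simp
    exact hs
  have hsum : ∑ i ∈ s, (1 - x i) * symmSum x (s.erase i) k =
      (s.card - k) * symmSum x s k - (k + 1) * symmSum x s (k + 1) := by
    rw [← sum_symmSum_erase, ← sum_mul_symmSum_erase, ← Finset.sum_sub_distrib]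
    exact Finset.sum_congr rfl fun i _ => by ring
  rw [← sub_nonneg, ← hsum]
  rcases s.eq_empty_or_nonempty with rfl | hne
  · simp
  · have : (0 : ℝ) < s.card := by exact_mod_cast hne.card_pos
    exact nonneg_of_mul_nonneg_right (hpos.trans hcheb) this

/-- The one-step inequality is iterated. Cross-multiplying avoids division by binomials, which
vanish beyond degree `s.card`. -/
theorem symmSum_le_of_le (hx : ∀ i, 0 ≤ x i) {s : Finset ι} (hs : ∑ i ∈ s, x i ≤ s.card)
    {k l : ℕ} (hkl : k ≤ l) :
    symmSum x s l * (s.card.choose k) ≤ symmSum x s k * (s.card.choose l) := by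
  induction l, hkl using Nat.le_induction with
  | base => rfl
  | succ l _ ih =>
    have h := succ_mul_symmSum_succ_le x hx hs l
    rcases lt_or_ge l s.card with hl | hl
    · have hc : (s.card.choose (l + 1) : ℝ) * (l + 1) = s.card.choose l * (s.card - l) := by
        have := Nat.choose_succ_right_eq s.card l
        rw [← Nat.cast_sub hl.le]
        exact_mod_cast this
      have hl' : (0 : ℝ) < l + 1 := by positivity
      have hd : (0 : ℝ) ≤ s.card - l := by
        rw [sub_nonneg]
        exact_mod_cast hl.le
      refine le_of_mul_le_mul_right ?_ hl'
      calc symmSum x s (l + 1) * s.card.choose k * (l + 1)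
          = ((l + 1) * symmSum x s (l + 1)) * s.card.choose k := by ring
        _ ≤ ((s.card - l) * symmSum x s l) * s.card.choose k := by gcongr
        _ = (s.card - l) * (symmSum x s l * s.card.choose k) := by ring
        _ ≤ (s.card - l) * (symmSum x s k * s.card.choose l) := by gcongr
        _ = symmSum x s k * s.card.choose (l + 1) * (l + 1) := by
          rw [mul_assoc _ _ ((l : ℝ) + 1), hc]
          ring
    · rw [symmSum_eq_zero x (by omega), zero_mul]
      exact mul_nonneg (symmSum_nonneg x hx _ _) (Nat.cast_nonneg _)

theorem symmSum_card_sub_le (hx : ∀ i, 0 ≤ x i) {s : Finset ι} (hs : ∑ i ∈ s, x i ≤ s.card)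
    {k : ℕ} (hk : 2 * k ≤ s.card) : symmSum x s (s.card - k) ≤ symmSum x s k := by
  have h := symmSum_le_of_le x hx hs (k := k) (l := s.card - k) (by omega)
  rw [Nat.choose_symm (by omega)] at h
  exact le_of_mul_le_mul_right h (by exact_mod_cast Nat.choose_pos (by omega))

end SymmSum

/-! ### Majorities of independent events -/

/-- The probability that at least `N+1` of the `2N+1` independent events of probabilities `p t`
occur. -/
noncomputable def majorityProb {N : ℕ} (p : Fin (2 * N + 1) → ℝ) : ℝ :=
  ∑ w : Finset (Fin (2 * N + 1)) with N + 1 ≤ w.card, (∏ t ∈ w, p t) * ∏ t ∈ wᶜ, (1 - p t)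

/-- Complementation: with an odd number of battles, exactly one team has a majority. -/
theorem majorityProb_one_sub {N : ℕ} (p : Fin (2 * N + 1) → ℝ) :
    majorityProb (fun t => 1 - p t) =
      ∑ w : Finset (Fin (2 * N + 1)) with ¬ N + 1 ≤ w.card,
        (∏ t ∈ w, p t) * ∏ t ∈ wᶜ, (1 - p t) := by
  refine Finset.sum_bij' (fun w _ => wᶜ) (fun w _ => wᶜ) ?_ ?_ ?_ ?_ ?_
  · intro w hw
    simp [Finset.card_compl] at hw ⊢
    omega
  · intro w hw
    simp [Finset.card_compl] at hw ⊢
    omega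
  · simp
  · simp
  · intro w _
    simp [mul_comm]

theorem majorityProb_add {N : ℕ} (p : Fin (2 * N + 1) → ℝ) :
    majorityProb p + majorityProb (fun t => 1 - p t) = 1 := by
  rw [majorityProb_one_sub, majorityProb, Finset.sum_filter_add_sum_filter_not,
    ← Fintype.prod_add]
  simp

theorem sum_card_le_eq_symmSum {ι : Type*} [Fintype ι] [DecidableEq ι] (x : ι → ℝ) (P : ℕ → Prop)
    [DecidablePred P] :
    ∑ w : Finset ι with P w.card, ∏ t ∈ w, x t =
      ∑ k ∈ Finset.range (Fintype.card ι + 1) with P k, symmSum x Finset.univ k := by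
  rw [Finset.sum_filter, ← Finset.powerset_univ, Finset.sum_powerset, Finset.sum_filter,
    Finset.card_univ]
  refine Finset.sum_congr rfl fun k _ => ?_
  by_cases hk : P k
  · rw [if_pos hk]
    exact Finset.sum_congr rfl fun T hT => by rw [(Finset.mem_powersetCard.1 hT).2, if_pos hk]
  · rw [if_neg hk]
    exact Finset.sum_eq_zero fun T hT => by rw [(Finset.mem_powersetCard.1 hT).2, if_neg hk]

theorem majorityProb_lt_half {N : ℕ} {x : Fin (2 * N + 1) → ℝ} (hx : ∀ t, 0 ≤ x t)
    (hs : ∑ t, x t ≤ 2 * N + 1) (hne : ∃ t, x t ≠ 1) :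
    majorityProb (fun t => x t / (1 + x t)) < 1 / 2 := by
  have hx1 : ∀ t, 0 < 1 + x t := fun t => by linarith [hx t]
  have hterm : ∀ w : Finset (Fin (2 * N + 1)),
      (∏ t ∈ w, x t / (1 + x t)) * ∏ t ∈ wᶜ, (1 - x t / (1 + x t)) =
        (∏ t ∈ w, x t) / ∏ t, (1 + x t) := by
    intro w
    have : ∀ t, 1 - x t / (1 + x t) = 1 / (1 + x t) := fun t => by
      field_simp [(hx1 t).ne']
      ring
    simp only [this, Finset.prod_div_distrib, Finset.prod_const_one]
    rw [div_mul_div_comm, mul_one, Finset.prod_mul_prod_compl]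
  have hs' : ∑ t, x t ≤ (Finset.univ : Finset (Fin (2 * N + 1))).card := by simpa using hs
  have hprod : 0 < ∏ t, (1 + x t) := Finset.prod_pos fun t _ => hx1 t
  have hadd := majorityProb_add (fun t => x t / (1 + x t))
  suffices h : majorityProb (fun t => x t / (1 + x t)) <
      majorityProb (fun t => 1 - x t / (1 + x t)) by linarith
  rw [majorityProb_one_sub, majorityProb]
  simp only [hterm]
  rw [← Finset.sum_div, ← Finset.sum_div]
  refine div_lt_div_of_pos_right ?_ hprod
  rw [sum_card_le_eq_symmSum x (fun k => N + 1 ≤ k), sum_card_le_eq_symmSum x (fun k => ¬ N + 1 ≤ k)]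
  -- The reflection k ↦ 2N+1-k pairs each majority size with a minority size.
  have hreflect : ∑ k ∈ Finset.range (Fintype.card (Fin (2 * N + 1)) + 1) with N + 1 ≤ k,
        symmSum x Finset.univ k =
      ∑ k ∈ Finset.range (Fintype.card (Fin (2 * N + 1)) + 1) with ¬ N + 1 ≤ k,
        symmSum x Finset.univ ((Finset.univ : Finset (Fin (2 * N + 1))).card - k) := by
    refine Finset.sum_bij' (fun k _ => 2 * N + 1 - k) (fun k _ => 2 * N + 1 - k) ?_ ?_ ?_ ?_ ?_
    · intro k hk
      simp at hk ⊢
      omega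
    · intro k hk
      simp at hk ⊢
      omega
    · intro k hk
      simp at hk
      omega
    · intro k hk
      simp at hk
      omega
    · intro k hk
      simp at hk ⊢
      congr 1
      omega
  rw [hreflect]
  -- Strictness comes from k = 0, where the comparison is ∏ x_t < 1.
  refine Finset.sum_lt_sum (fun k hk => symmSum_card_sub_le x hx hs' ?_) ⟨0, ?_, ?_⟩
  · simp at hk ⊢
    omega
  · simp
  · rw [Nat.sub_zero, symmSum_card, symmSum_zero]
    obtain ⟨t, ht⟩ := hne
    exact prod_lt_one_of_sum_le x hx hs' ⟨t, Finset.mem_univ t, ht⟩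

/-- Bernoulli's bound at the proportional share has slope (∑ r)/W in v_t, the same for every battle,
so the sum of the bounds depends on v only through its total. -/
theorem sum_rpow_div_le {ι : Type*} [Fintype ι] [Nonempty ι] {r v : ι → ℝ} {W : ℝ}
    (hr : ∀ t, 0 < r t) (hr1 : ∀ t, r t ≤ 1) (hW : 0 < W) (hv : ∀ t, 0 ≤ v t)
    (hsum : ∑ t, v t = W) :
    ∑ t, (v t / (W * r t / ∑ s, r s)) ^ r t ≤ Fintype.card ι := by
  have hR : 0 < ∑ s, r s := Finset.sum_pos (fun t _ => hr t) Finset.univ_nonempty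
  have hle : ∀ t, (v t / (W * r t / ∑ s, r s)) ^ r t ≤ 1 + (v t * (∑ s, r s) / W - r t) := by
    intro t
    have hpos : 0 < W * r t / ∑ s, r s := div_pos (mul_pos hW (hr t)) hR
    have h := rpow_one_add_le_one_add_mul_self (s := v t / (W * r t / ∑ s, r s) - 1)
      (by have := div_nonneg (hv t) hpos.le; linarith) (hr t).le (hr1 t)
    rw [add_sub_cancel] at h
    refine h.trans_eq ?_
    have := (hr t).ne'
    field_simp
  refine (Finset.sum_le_sum fun t _ => hle t).trans_eq ?_
  rw [Finset.sum_add_distrib, Finset.sum_sub_distrib, ← Finset.sum_div, ← Finset.sum_mul, hsum,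
    mul_div_cancel_left₀ _ hW.ne']
  simp

/-! ### The managers' reduced-form game -/

namespace TeamContest

variable {N : ℕ}

theorem probA_eq_majorityProb (C : TeamContest N) (vA vB : Fin (2 * N + 1) → ℝ) :
    C.probA vA vB = majorityProb (C.pA vA vB) := rfl

theorem probB_eq_majorityProb (C : TeamContest N) (vA vB : Fin (2 * N + 1) → ℝ) :
    C.probB vA vB = majorityProb (C.pB vA vB) := by
  simp [probB, majorityProb, pB]

theorem probB_eq_one_sub_probA (C : TeamContest N) (vA vB : Fin (2 * N + 1) → ℝ) :
    C.probB vA vB = 1 - C.probA vA vB := by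
  have h := majorityProb_add (C.pA vA vB)
  rw [probB_eq_majorityProb, probA_eq_majorityProb]
  exact eq_sub_of_add_eq' h

/-- The division of the prize `W` in proportion to the discriminatory powers. -/
noncomputable def powerShares (C : TeamContest N) (W : ℝ) (t : Fin (2 * N + 1)) : ℝ :=
  W * C.r t / ∑ s, C.r s

theorem sum_r_pos (C : TeamContest N) : 0 < ∑ s, C.r s :=
  Finset.sum_pos (fun t _ => C.r_pos t) Finset.univ_nonempty

theorem powerShares_pos (C : TeamContest N) {W : ℝ} (hW : 0 < W) (t : Fin (2 * N + 1)) :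
    0 < C.powerShares W t :=
  div_pos (mul_pos hW (C.r_pos t)) C.sum_r_pos

theorem powerShares_mem (C : TeamContest N) {W : ℝ} (hW : 0 < W) :
    C.powerShares W ∈ prizeDivisions N W := by
  refine ⟨fun t => (C.powerShares_pos hW t).le, ?_⟩
  unfold powerShares
  rw [← Finset.sum_div, ← Finset.mul_sum, mul_div_cancel_right₀ _ C.sum_r_pos.ne']

/-- The probability of winning a majority with odds given by a division relative to the
proportional one is less than one half, unless the division is proportional itself. -/
theorem majorityProb_odds_lt_half (C : TeamContest N) {W : ℝ} (hW : 0 < W)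
    {v : Fin (2 * N + 1) → ℝ} (hv : v ∈ prizeDivisions N W) (hne : v ≠ C.powerShares W) :
    majorityProb (fun t => (v t / C.powerShares W t) ^ C.r t /
      (1 + (v t / C.powerShares W t) ^ C.r t)) < 1 / 2 := by
  have hs : ∀ t, 0 ≤ v t / C.powerShares W t := fun t =>
    div_nonneg (hv.1 t) (C.powerShares_pos hW t).le
  refine majorityProb_lt_half (fun t => Real.rpow_nonneg (hs t) _) ?_ ?_
  · have h := sum_rpow_div_le C.r_pos C.r_le_one hW hv.1 hv.2
    rw [Fintype.card_fin] at h
    exact_mod_cast h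
  · by_contra! hall
    refine hne (funext fun t => ?_)
    rw [← div_eq_one_iff_eq (C.powerShares_pos hW t).ne']
    exact Real.rpow_left_injOn (C.r_pos t).ne' (hs t) (Set.mem_Ici.2 zero_le_one)
      ((hall t).trans (Real.one_rpow _).symm)

/-- The contest is balanced when the cost ratio of every battle equals the prize ratio. -/
theorem cost_ratio_eq (C : TeamContest N)
    (hbal : ∀ t, (C.cB t / C.cA t) ^ C.r t = (C.WB / C.WA) ^ C.r t) (t : Fin (2 * N + 1)) :
    C.WA / C.cA t = C.WB / C.cB t := by
  have h : C.cB t / C.cA t = C.WB / C.WA :=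
    Real.rpow_left_injOn (C.r_pos t).ne' (div_pos (C.cB_pos t) (C.cA_pos t)).le
      (div_pos C.WB_pos C.WA_pos).le (hbal t)
  have := C.cA_pos t
  have := C.cB_pos t
  have := C.WA_pos
  rw [div_eq_div_iff (by positivity) (by positivity)] at h ⊢
  linarith

theorem powerShares_div_cost_eq (C : TeamContest N)
    (hbal : ∀ t, (C.cB t / C.cA t) ^ C.r t = (C.WB / C.WA) ^ C.r t) (t : Fin (2 * N + 1)) :
    C.powerShares C.WA t / C.cA t = C.powerShares C.WB t / C.cB t := by
  have h := C.cost_ratio_eq hbal t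
  calc C.powerShares C.WA t / C.cA t = C.WA / C.cA t * (C.r t / ∑ s, C.r s) := by
        unfold powerShares
        ring
    _ = C.powerShares C.WB t / C.cB t := by
        rw [h]
        unfold powerShares
        ring

theorem rpow_div_rpow_add_rpow {s z r : ℝ} (hs : 0 ≤ s) (hz : 0 < z) :
    (s * z) ^ r / ((s * z) ^ r + z ^ r) = s ^ r / (1 + s ^ r) := by
  have hzr : 0 < z ^ r := Real.rpow_pos_of_pos hz r
  have hsr : 0 ≤ s ^ r := Real.rpow_nonneg hs r
  rw [Real.mul_rpow hs hz.le, div_eq_div_iff (by positivity) (by positivity)]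
  ring

theorem pA_powerShares_right (C : TeamContest N)
    (hbal : ∀ t, (C.cB t / C.cA t) ^ C.r t = (C.WB / C.WA) ^ C.r t)
    {v : Fin (2 * N + 1) → ℝ} (hv : ∀ t, 0 ≤ v t) (t : Fin (2 * N + 1)) :
    C.pA v (C.powerShares C.WB) t = (v t / C.powerShares C.WA t) ^ C.r t /
      (1 + (v t / C.powerShares C.WA t) ^ C.r t) := by
  have hA := C.powerShares_pos C.WA_pos t
  have hB := C.powerShares_pos C.WB_pos t
  rw [pA, if_neg fun h => hB.ne' h.2, ← rpow_div_rpow_add_rpow (div_nonneg (hv t) hA.le)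
    (div_pos hB (C.cB_pos t))]
  have : v t / C.powerShares C.WA t * (C.powerShares C.WB t / C.cB t) = v t / C.cA t := by
    rw [← C.powerShares_div_cost_eq hbal]
    field_simp
  rw [this]

theorem pB_powerShares_left (C : TeamContest N)
    (hbal : ∀ t, (C.cB t / C.cA t) ^ C.r t = (C.WB / C.WA) ^ C.r t)
    {v : Fin (2 * N + 1) → ℝ} (hv : ∀ t, 0 ≤ v t) (t : Fin (2 * N + 1)) :
    C.pB (C.powerShares C.WA) v t = (v t / C.powerShares C.WB t) ^ C.r t /
      (1 + (v t / C.powerShares C.WB t) ^ C.r t) := by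
  have hA := C.powerShares_pos C.WA_pos t
  have hB := C.powerShares_pos C.WB_pos t
  have hz := div_pos hA (C.cA_pos t)
  rw [pB, pA, if_neg fun h => hA.ne' h.1, ← rpow_div_rpow_add_rpow (div_nonneg (hv t) hB.le) hz]
  have : v t / C.powerShares C.WB t * (C.powerShares C.WA t / C.cA t) = v t / C.cB t := by
    rw [C.powerShares_div_cost_eq hbal]
    field_simp
  rw [this]
  have h1 : 0 < (C.powerShares C.WA t / C.cA t) ^ C.r t := Real.rpow_pos_of_pos hz _
  have h2 : 0 ≤ (v t / C.cB t) ^ C.r t :=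
    Real.rpow_nonneg (div_nonneg (hv t) (C.cB_pos t).le) _
  field_simp
  ring

theorem pA_powerShares (C : TeamContest N)
    (hbal : ∀ t, (C.cB t / C.cA t) ^ C.r t = (C.WB / C.WA) ^ C.r t) (t : Fin (2 * N + 1)) :
    C.pA (C.powerShares C.WA) (C.powerShares C.WB) t = 1 / 2 := by
  have hA := fun s => C.powerShares_pos C.WA_pos s
  rw [C.pA_powerShares_right hbal fun s => (hA s).le, div_self (hA t).ne', Real.one_rpow]
  norm_num

theorem probA_powerShares (C : TeamContest N)
    (hbal : ∀ t, (C.cB t / C.cA t) ^ C.r t = (C.WB / C.WA) ^ C.r t) :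
    C.probA (C.powerShares C.WA) (C.powerShares C.WB) = 1 / 2 := by
  have h := majorityProb_add (C.pA (C.powerShares C.WA) (C.powerShares C.WB))
  have h1 : C.pA (C.powerShares C.WA) (C.powerShares C.WB) = fun _ => 1 / 2 :=
    funext (C.pA_powerShares hbal)
  have h2 : (fun _ : Fin (2 * N + 1) => 1 - (1 : ℝ) / 2) = fun _ => 1 / 2 := by norm_num
  rw [h1, h2] at h
  rw [probA_eq_majorityProb, h1]
  linarith

theorem probA_lt_half (C : TeamContest N)
    (hbal : ∀ t, (C.cB t / C.cA t) ^ C.r t = (C.WB / C.WA) ^ C.r t)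
    {v : Fin (2 * N + 1) → ℝ} (hv : v ∈ prizeDivisions N C.WA) (hne : v ≠ C.powerShares C.WA) :
    C.probA v (C.powerShares C.WB) < 1 / 2 := by
  rw [probA_eq_majorityProb, funext (C.pA_powerShares_right hbal hv.1)]
  exact C.majorityProb_odds_lt_half C.WA_pos hv hne

theorem probB_lt_half (C : TeamContest N)
    (hbal : ∀ t, (C.cB t / C.cA t) ^ C.r t = (C.WB / C.WA) ^ C.r t)
    {v : Fin (2 * N + 1) → ℝ} (hv : v ∈ prizeDivisions N C.WB) (hne : v ≠ C.powerShares C.WB) :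
    C.probB (C.powerShares C.WA) v < 1 / 2 := by
  rw [probB_eq_majorityProb, funext (C.pB_powerShares_left hbal hv.1)]
  exact C.majorityProb_odds_lt_half C.WB_pos hv hne

theorem isReducedEquilibrium_iff (C : TeamContest N)
    (hbal : ∀ t, (C.cB t / C.cA t) ^ C.r t = (C.WB / C.WA) ^ C.r t)
    (vA vB : Fin (2 * N + 1) → ℝ) :
    C.IsReducedEquilibrium vA vB ↔ vA = C.powerShares C.WA ∧ vB = C.powerShares C.WB := by
  have hmemA := C.powerShares_mem C.WA_pos
  have hmemB := C.powerShares_mem C.WB_pos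
  have hhalf := C.probA_powerShares hbal
  constructor
  · rintro ⟨hA, hB, hbestA, hbestB⟩
    have h1 := hbestA _ hmemA
    have h2 := hbestB _ hmemB
    have h3 := C.probB_eq_one_sub_probA vA vB
    have h4 := C.probB_eq_one_sub_probA vA (C.powerShares C.WB)
    have h5 := C.probB_eq_one_sub_probA (C.powerShares C.WA) vB
    have hleA : C.probA vA (C.powerShares C.WB) ≤ 1 / 2 := by
      by_cases h : vA = C.powerShares C.WA
      · rw [h, hhalf]
      · exact (C.probA_lt_half hbal hA h).le
    have hleB : C.probB (C.powerShares C.WA) vB ≤ 1 / 2 := by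
      by_cases h : vB = C.powerShares C.WB
      · rw [h, probB_eq_one_sub_probA, hhalf]
        norm_num
      · exact (C.probB_lt_half hbal hB h).le
    -- Each side can secure 1/2 by switching to its proportional division, while a non-proportional
    -- choice would let the rival's switch push it strictly below 1/2.
    constructor
    · by_contra h
      linarith [C.probA_lt_half hbal hA h]
    · by_contra h
      linarith [C.probB_lt_half hbal hB h]
  · rintro ⟨rfl, rfl⟩
    refine ⟨hmemA, hmemB, fun v hv => ?_, fun v hv => ?_⟩
    · by_cases h : v = C.powerShares C.WA
      · rw [h]
      · rw [hhalf]
        exact (C.probA_lt_half hbal hv h).le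
    · by_cases h : v = C.powerShares C.WB
      · rw [h]
      · rw [C.probB_eq_one_sub_probA _ (C.powerShares C.WB), hhalf]
        linarith [C.probB_lt_half hbal hv h]

end TeamContest

/-! ### Equilibrium of a single battle -/

theorem tullock_zero_zero (r : ℝ) : tullock r 0 0 = 1 / 2 := by
  simp [tullock]

theorem tullock_of_pos_left {r x : ℝ} (hx : 0 < x) (y : ℝ) :
    tullock r x y = x ^ r / (x ^ r + y ^ r) := by
  rw [tullock, if_neg fun h => hx.ne' h.1]

theorem tullock_pos_zero {r x : ℝ} (hr : 0 < r) (hx : 0 < x) : tullock r x 0 = 1 := by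
  rw [tullock_of_pos_left hx, Real.zero_rpow hr.ne', add_zero,
    div_self (Real.rpow_pos_of_pos hx r).ne']

theorem one_sub_tullock {r x y : ℝ} (hx : 0 ≤ x) (hy : 0 ≤ y) :
    1 - tullock r x y = tullock r y x := by
  by_cases h : x = 0 ∧ y = 0
  · rw [h.1, h.2, tullock_zero_zero]
    norm_num
  · rw [tullock, tullock, if_neg h, if_neg fun h' => h ⟨h'.2, h'.1⟩]
    have hpos : 0 < x ^ r + y ^ r := by
      rcases hx.eq_or_lt with hx0 | hx0
      · rcases hy.eq_or_lt with hy0 | hy0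
        · exact absurd ⟨hx0.symm, hy0.symm⟩ h
        · exact add_pos_of_nonneg_of_pos (Real.rpow_nonneg hx r) (Real.rpow_pos_of_pos hy0 r)
      · exact add_pos_of_pos_of_nonneg (Real.rpow_pos_of_pos hx0 r) (Real.rpow_nonneg hy r)
    rw [add_comm (y ^ r), eq_div_iff hpos.ne', sub_mul, div_mul_cancel₀ _ hpos.ne']
    ring

theorem tullock_zero_pos {r y : ℝ} (hr : 0 < r) (hy : 0 < y) : tullock r 0 y = 0 := by
  rw [← one_sub_tullock hy.le le_rfl, tullock_pos_zero hr hy, sub_self]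

theorem tullock_mem_Icc {r x y : ℝ} (hx : 0 ≤ x) (hy : 0 ≤ y) : tullock r x y ∈ Set.Icc 0 1 := by
  have hnonneg : ∀ {x y : ℝ}, 0 ≤ x → 0 ≤ y → 0 ≤ tullock r x y := by
    intro x y hx hy
    have := Real.rpow_nonneg hx r
    have := Real.rpow_nonneg hy r
    unfold tullock
    split_ifs <;> positivity
  refine ⟨hnonneg hx hy, ?_⟩
  rw [← sub_nonneg, one_sub_tullock hx hy]
  exact hnonneg hy hx

theorem tullock_pos {r x y : ℝ} (hx : 0 < x) (hy : 0 ≤ y) : 0 < tullock r x y := by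
  have := Real.rpow_pos_of_pos hx r
  have := Real.rpow_nonneg hy r
  rw [tullock_of_pos_left hx]
  positivity

theorem tullock_mul_mul {r k x y : ℝ} (hk : 0 < k) (hx : 0 ≤ x) (hy : 0 ≤ y) :
    tullock r (k * x) (k * y) = tullock r x y := by
  have hkr := (Real.rpow_pos_of_pos hk r).ne'
  simp only [tullock, mul_eq_zero, hk.ne', false_or, Real.mul_rpow hk.le hx, Real.mul_rpow hk.le hy,
    ← mul_add, mul_div_mul_left _ _ hkr]

/-- The effort `x` is a best reply to the effort `y` of the opponent, for a player of marginal cost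
`c` whose gain from winning the battle is `α`. -/
def IsBestEffort (r α c x y : ℝ) : Prop :=
  0 ≤ x ∧ ∀ x', 0 ≤ x' → α * tullock r x' y - c * x' ≤ α * tullock r x y - c * x

/-- Payoffs are affine in the win probability; their constant parts drop out and both prizes are
scaled by V1 - V0. -/
theorem isNash_battle_iff {r cA cB vA vB V1 V0 eA eB : ℝ} :
    IsNash (Set.Ici 0) (Set.Ici 0)
      (fun x y => vA * (tullock r x y * V1 + (1 - tullock r x y) * V0) - cA * x)
      (fun x y => vB * (1 - (tullock r x y * V1 + (1 - tullock r x y) * V0)) - cB * y) eA eB ↔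
    IsBestEffort r ((V1 - V0) * vA) cA eA eB ∧ IsBestEffort r ((V1 - V0) * vB) cB eB eA := by
  have hA : ∀ x y, vA * (tullock r x y * V1 + (1 - tullock r x y) * V0) - cA * x =
      vA * V0 + ((V1 - V0) * vA * tullock r x y - cA * x) := fun x y => by ring
  have hB : ∀ x y, 0 ≤ x → 0 ≤ y →
      vB * (1 - (tullock r x y * V1 + (1 - tullock r x y) * V0)) - cB * y =
      vB * (1 - V1) + ((V1 - V0) * vB * tullock r y x - cB * y) := fun x y hx hy => by
    rw [← one_sub_tullock hx hy]
    ring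
  constructor
  · rintro ⟨heA, heB, hbestA, hbestB⟩
    refine ⟨⟨heA, fun x hx => ?_⟩, heB, fun y hy => ?_⟩
    · have := hbestA x hx
      simp only [hA] at this
      linarith
    · have := hbestB y hy
      simp only [hB _ _ heA heB, hB _ _ heA hy] at this
      linarith
  · rintro ⟨⟨heA, hbestA⟩, heB, hbestB⟩
    refine ⟨heA, heB, fun x hx => ?_, fun y hy => ?_⟩
    · have := hbestA x hx
      simp only [hA]
      linarith
    · have := hbestB y hy
      simp only [hB _ _ heA heB, hB _ _ heA hy]
      linarith

theorem isBestEffort_zero {r c : ℝ} (hc : 0 < c) (x y : ℝ) :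
    IsBestEffort r 0 c x y ↔ x = 0 := by
  constructor
  · rintro ⟨hx, h⟩
    have := h 0 le_rfl
    nlinarith
  · rintro rfl
    refine ⟨le_rfl, fun x' hx' => ?_⟩
    have := mul_nonneg hc.le hx'
    linarith

theorem not_isBestEffort_zero_right {r α c : ℝ} (hr : 0 < r) (hα : 0 < α) (hc : 0 < c) (x : ℝ) :
    ¬ IsBestEffort r α c x 0 := by
  rintro ⟨hx, h⟩
  rcases hx.eq_or_lt with rfl | hx
  · have hpos : 0 < α / (4 * c) := by positivity
    have := h _ hpos.le
    rw [tullock_pos_zero hr hpos, tullock_zero_zero] at this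
    have : c * (α / (4 * c)) = α / 4 := by field_simp
    linarith
  · have := h _ (half_pos hx).le
    rw [tullock_pos_zero hr (half_pos hx), tullock_pos_zero hr hx] at this
    nlinarith

/-- The first-order condition for a best reply. -/
theorem IsBestEffort.first_order {r α c x y : ℝ} (hx : 0 < x) (hy : 0 < y)
    (h : IsBestEffort r α c x y) :
    α * (r * (tullock r x y * tullock r y x)) = c * x := by
  have hX := Real.rpow_pos_of_pos hx r
  have hY := Real.rpow_pos_of_pos hy r
  have hd : HasDerivAt (fun z : ℝ => z ^ r) (r * x ^ (r - 1)) x :=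
    Real.hasDerivAt_rpow_const (Or.inl hx.ne')
  have hderiv := ((hd.div (hd.add_const (y ^ r)) (by positivity)).const_mul α).sub
    ((hasDerivAt_id x).const_mul c)
  have hmax : IsLocalMax (fun z : ℝ => α * (z ^ r / (z ^ r + y ^ r)) - c * z) x := by
    filter_upwards [lt_mem_nhds hx] with z hz
    have := h.2 z (le_of_lt hz)
    rwa [tullock_of_pos_left hz, tullock_of_pos_left hx] at this
  have hzero := hmax.hasDerivAt_eq_zero hderiv
  have hpow : x ^ r = x ^ (r - 1) * x := by
    rw [← Real.rpow_add_one hx.ne', sub_add_cancel]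
  rw [tullock_of_pos_left hx, tullock_of_pos_left hy]
  have hfoc : α * (r * x ^ (r - 1) * y ^ r / (x ^ r + y ^ r) ^ 2) = c := by
    rw [← sub_eq_zero, ← hzero]
    ring
  rw [← hfoc, add_comm (y ^ r), div_mul_div_comm, ← sq]
  nth_rewrite 1 [hpow]
  ring

/-- With x' = s x and u = s^r, the win probability is concave in u, hence below its tangent at u =
1; Bernoulli bounds u - 1 by r(s - 1), and the first-order condition equates the resulting gain with
the extra cost. -/
theorem isBestEffort_of_first_order {r α c x y : ℝ} (hr : 0 < r) (hr1 : r ≤ 1) (hα : 0 ≤ α)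
    (hx : 0 < x) (hy : 0 < y) (hfoc : α * (r * (tullock r x y * tullock r y x)) = c * x) :
    IsBestEffort r α c x y := by
  refine ⟨hx.le, fun x' hx' => ?_⟩
  set p := tullock r x y with hp
  have hq : tullock r y x = 1 - p := (one_sub_tullock hx.le hy.le).symm
  have hp0 : 0 < p := tullock_pos hx hy.le
  have hp1 : 0 < 1 - p := hq ▸ tullock_pos hy hx.le
  obtain ⟨s, hs, rfl⟩ : ∃ s, 0 ≤ s ∧ s * x = x' :=
    ⟨x' / x, div_nonneg hx' hx.le, div_mul_cancel₀ _ hx.ne'⟩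
  have hu : s ^ r ≤ 1 + r * (s - 1) := by
    have := rpow_one_add_le_one_add_mul_self (s := s - 1) (by linarith) hr.le hr1
    rwa [add_sub_cancel] at this
  set u := s ^ r with hu_def
  have hu0 : 0 ≤ u := Real.rpow_nonneg hs r
  have hX := Real.rpow_pos_of_pos hx r
  have hY := Real.rpow_pos_of_pos hy r
  have hden : 0 < 1 + p * (u - 1) := by nlinarith [mul_nonneg hp0.le hu0]
  have hT : tullock r (s * x) y = p * u / (1 + p * (u - 1)) := by
    rw [tullock, if_neg fun h => hy.ne' h.2, Real.mul_rpow hs hx.le, ← hu_def]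
    rw [div_eq_div_iff (by positivity) hden.ne', hp, tullock_of_pos_left hx]
    field_simp
    ring
  have hgain : p * u / (1 + p * (u - 1)) - p ≤ p * (1 - p) * (r * (s - 1)) := by
    have h1 : p * u / (1 + p * (u - 1)) - p ≤ p * (1 - p) * (u - 1) := by
      rw [div_sub' hden.ne', div_le_iff₀ hden]
      nlinarith [mul_nonneg (mul_nonneg hp0.le hp1.le) (mul_nonneg hp0.le (sq_nonneg (u - 1)))]
    refine h1.trans (mul_le_mul_of_nonneg_left (by linarith) (by positivity))
  rw [hT]
  rw [hq] at hfoc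
  have h2 := mul_le_mul_of_nonneg_left hgain hα
  have h3 : α * (p * (1 - p) * (r * (s - 1))) = c * (s * x) - c * x := by
    rw [show α * (p * (1 - p) * (r * (s - 1))) = α * (r * (p * (1 - p))) * (s - 1) by ring, hfoc]
    ring
  rw [h3] at h2
  linarith

section Battle

variable {r cA cB vA vB V1 V0 p : ℝ}

theorem isBattleOutcome_half_of_eq (hcA : 0 < cA) (hcB : 0 < cB) :
    IsBattleOutcome r cA cB vA vB V1 V1 (1 / 2) := by
  refine Or.inl ⟨0, 0, isNash_battle_iff.2 ?_, (tullock_zero_zero r).symm⟩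
  rw [sub_self, zero_mul, zero_mul]
  exact ⟨(isBestEffort_zero hcA _ _).2 rfl, (isBestEffort_zero hcB _ _).2 rfl⟩

/-- Zero effort by one side leaves the other without a best reply. For positive efforts the two
first-order conditions share the factor k = r·p·(1-p), so x = k α/cA and y = k β/cB, and homogeneity
removes k. -/
theorem isBestEffort_pair_iff (hr : 0 < r) (hr1 : r ≤ 1) {α β : ℝ} (hcA : 0 < cA) (hcB : 0 < cB)
    (hα : 0 < α) (hβ : 0 < β) :
    (∃ x y, IsBestEffort r α cA x y ∧ IsBestEffort r β cB y x ∧ p = tullock r x y) ↔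
      p = tullock r (α / cA) (β / cB) := by
  have ha : 0 < α / cA := by positivity
  have hb : 0 < β / cB := by positivity
  have hscale : ∀ {α c k : ℝ}, 0 < c → k * (α / c) * c = α * k := fun {α c k} hc => by
    field_simp
  constructor
  · rintro ⟨x, y, hA, hB, rfl⟩
    have hx : 0 < x := hA.1.lt_of_ne fun h => not_isBestEffort_zero_right hr hβ hcB y (h ▸ hB)
    have hy : 0 < y := hB.1.lt_of_ne fun h => not_isBestEffort_zero_right hr hα hcA x (h ▸ hA)
    have hk : 0 < r * (tullock r x y * tullock r y x) :=
      mul_pos hr (mul_pos (tullock_pos hx hy.le) (tullock_pos hy hx.le))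
    have h1 := hA.first_order hx hy
    have h2 := hB.first_order hy hx
    rw [mul_comm (tullock r y x)] at h2
    set k := r * (tullock r x y * tullock r y x) with hk_def
    have hx' : x = k * (α / cA) := by
      field_simp
      linarith
    have hy' : y = k * (β / cB) := by
      field_simp
      linarith
    conv_lhs => rw [hx', hy']
    exact tullock_mul_mul hk ha.le hb.le
  · rintro rfl
    have hk : 0 < r * (tullock r (α / cA) (β / cB) * tullock r (β / cB) (α / cA)) :=
      mul_pos hr (mul_pos (tullock_pos ha hb.le) (tullock_pos hb ha.le))
    have hab := tullock_mul_mul (r := r) hk ha.le hb.le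
    have hba := tullock_mul_mul (r := r) hk hb.le ha.le
    refine ⟨_, _, isBestEffort_of_first_order hr hr1 hα.le (mul_pos hk ha) (mul_pos hk hb) ?_,
      isBestEffort_of_first_order hr hr1 hβ.le (mul_pos hk hb) (mul_pos hk ha) ?_, hab.symm⟩
    · rw [hab, hba, mul_comm cA, hscale hcA]
    · rw [hab, hba, mul_comm cB, hscale hcB, mul_comm (tullock r (β / cB) _)]

/-- In a battle that matters, the equilibrium outcome is given by the reduced form. -/
theorem isBattleOutcome_iff (hr : 0 < r) (hr1 : r ≤ 1) (hcA : 0 < cA) (hcB : 0 < cB)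
    (hvA : 0 ≤ vA) (hvB : 0 ≤ vB) (hV : V0 < V1) :
    IsBattleOutcome r cA cB vA vB V1 V0 p ↔ p = tullock r (vA / cA) (vB / cB) := by
  have hd : 0 < V1 - V0 := sub_pos.2 hV
  unfold IsBattleOutcome
  simp only [isNash_battle_iff, hV, true_and, and_assoc]
  -- If exactly one prize is zero, its holder exerts no effort, so no equilibrium exists and only
  -- the convention for this case remains.
  rcases hvA.eq_or_lt with rfl | hvA <;> rcases hvB.eq_or_lt with rfl | hvB
  · simp only [mul_zero, isBestEffort_zero hcA, isBestEffort_zero hcB, zero_div, lt_irrefl,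
      false_and, and_false, or_false]
    exact ⟨fun ⟨x, y, hx, hy, h⟩ => by rw [h, hx, hy], fun h => ⟨0, 0, rfl, rfl, h⟩⟩
  · simp only [mul_zero, isBestEffort_zero hcA, zero_div, tullock_zero_pos hr (div_pos hvB hcB)]
    constructor
    · rintro (⟨x, y, rfl, hy, -⟩ | ⟨-, -, h⟩ | ⟨h, -⟩)
      · exact absurd hy (not_isBestEffort_zero_right hr (mul_pos hd hvB) hcB y)
      · exact h
      · exact absurd h (lt_irrefl 0)
    · exact fun h => Or.inr (Or.inl ⟨trivial, hvB, h⟩)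
  · simp only [mul_zero, isBestEffort_zero hcB, zero_div, tullock_pos_zero hr (div_pos hvA hcA)]
    constructor
    · rintro (⟨x, y, hx, rfl, -⟩ | ⟨-, h, -⟩ | ⟨-, -, h⟩)
      · exact absurd hx (not_isBestEffort_zero_right hr (mul_pos hd hvA) hcA x)
      · exact absurd h (lt_irrefl 0)
      · exact h
    · exact fun h => Or.inr (Or.inr ⟨hvA, trivial, h⟩)
  · simp only [hvA.ne', hvB.ne', false_and, and_false, or_false]
    rw [isBestEffort_pair_iff hr hr1 hcA hcB (mul_pos hd hvA) (mul_pos hd hvB), mul_div_assoc,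
      mul_div_assoc, tullock_mul_mul hd (div_pos hvA hcA).le (div_pos hvB hcB).le]

end Battle

/-! ### The sequence of battles -/

section Contest

variable {N : ℕ}

/-- With history-independent probabilities, an additional victory never hurts. -/
theorem contestWinProb_mono {p : Fin (2 * N + 1) → ℝ} (hp : ∀ t, p t ∈ Set.Icc 0 1) (m : ℕ)
    {w w' : Finset (Fin (2 * N + 1))} (h : w ⊆ w') :
    contestWinProb (fun t _ => p t) m w ≤ contestWinProb (fun t _ => p t) m w' := by
  induction m generalizing w w' with
  | zero =>
    have := Finset.card_le_card h
    simp only [contestWinProb]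
    split_ifs <;> first | omega | norm_num
  | succ m ih =>
    simp only [contestWinProb]
    have h0 := (hp ⟨2 * N - m, by omega⟩).1
    have h1 := sub_nonneg.2 (hp ⟨2 * N - m, by omega⟩).2
    gcongr
    · exact ih (Finset.insert_subset_insert _ h)
    · exact ih h

/-- S collects the victories among the last m battles, those of index at least 2N+1-m; the induction
adds battle 2N-m in front. -/
theorem contestWinProb_eq_sum (p : Fin (2 * N + 1) → ℝ) {m : ℕ} (hm : m ≤ 2 * N + 1)
    (w : Finset (Fin (2 * N + 1))) :
    contestWinProb (fun t _ => p t) m w =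
      ∑ S ∈ (Finset.univ.filter fun t : Fin (2 * N + 1) => 2 * N + 1 ≤ t + m).powerset,
        ((∏ t ∈ S, p t) *
          ∏ t ∈ (Finset.univ.filter fun t : Fin (2 * N + 1) => 2 * N + 1 ≤ t + m) \ S,
            (1 - p t)) * if N + 1 ≤ (w ∪ S).card then 1 else 0 := by
  induction m generalizing w with
  | zero =>
    have : (Finset.univ.filter fun t : Fin (2 * N + 1) => 2 * N + 1 ≤ t + 0) = ∅ := by
      ext t
      have := t.isLt
      simp
      omega
    rw [this]
    simp [contestWinProb]
  | succ m ih =>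
    set B := Finset.univ.filter fun t : Fin (2 * N + 1) => 2 * N + 1 ≤ t + m with hB
    set a : Fin (2 * N + 1) := ⟨2 * N - m, by omega⟩ with ha
    have haB : a ∉ B := by
      simp [hB, ha]
      omega
    have hins : (Finset.univ.filter fun t : Fin (2 * N + 1) => 2 * N + 1 ≤ t + (m + 1)) =
        insert a B := by
      ext t
      simp [hB, ha, Fin.ext_iff]
      omega
    rw [hins, Finset.sum_powerset_insert haB]
    simp only [contestWinProb, ← ha]
    rw [ih (by omega), ih (by omega), add_comm, Finset.mul_sum, Finset.mul_sum]
    congr 1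
    · refine Finset.sum_congr rfl fun S hS => ?_
      have haS : a ∉ S := fun h => haB (Finset.mem_powerset.1 hS h)
      rw [Finset.insert_sdiff_of_notMem _ haS, Finset.prod_insert (by simp [haB])]
      ring
    · refine Finset.sum_congr rfl fun S hS => ?_
      have haS : a ∉ S := fun h => haB (Finset.mem_powerset.1 hS h)
      have hdiff : insert a B \ insert a S = B \ S := by
        rw [Finset.insert_sdiff_insert, Finset.sdiff_insert_of_notMem haB]
      rw [hdiff, Finset.prod_insert haS, Finset.union_insert, Finset.insert_union]
      ring

theorem contestWinProb_eq_majorityProb (p : Fin (2 * N + 1) → ℝ) :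
    contestWinProb (fun t _ => p t) (2 * N + 1) ∅ = majorityProb p := by
  have : (Finset.univ.filter fun t : Fin (2 * N + 1) => 2 * N + 1 ≤ t + (2 * N + 1)) =
      Finset.univ := by
    ext t
    simp
  rw [contestWinProb_eq_sum p le_rfl, this, majorityProb, Finset.sum_filter, Finset.powerset_univ]
  refine Finset.sum_congr rfl fun S _ => ?_
  rw [Finset.empty_union, mul_ite, mul_one, mul_zero, ← Finset.compl_eq_univ_sdiff]

/-- If `q` agrees with the history-independent `p` in every battle that matters, it yields the same
probabilities of winning the contest. -/
theorem contestWinProb_congr {p : Fin (2 * N + 1) → ℝ}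
    {q : Fin (2 * N + 1) → Finset (Fin (2 * N + 1)) → ℝ} {m : ℕ} (hm : m ≤ 2 * N + 1)
    (hq : ∀ t : Fin (2 * N + 1), 2 * N + 1 ≤ t + m → ∀ w : Finset (Fin (2 * N + 1)),
      (∀ s ∈ w, s < t) →
      (∀ w' : Finset (Fin (2 * N + 1)), (∀ s ∈ w', s ≤ t) →
        contestWinProb q (2 * N - t) w' = contestWinProb (fun t _ => p t) (2 * N - t) w') →
      contestWinProb (fun t _ => p t) (2 * N - t) w ≠
        contestWinProb (fun t _ => p t) (2 * N - t) (insert t w) → q t w = p t)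
    {w : Finset (Fin (2 * N + 1))} (hw : ∀ s ∈ w, (s : ℕ) + m < 2 * N + 1) :
    contestWinProb q m w = contestWinProb (fun t _ => p t) m w := by
  induction m generalizing w with
  | zero => rfl
  | succ m ih =>
    have ih' : ∀ {w : Finset (Fin (2 * N + 1))}, (∀ s ∈ w, (s : ℕ) + m < 2 * N + 1) →
        contestWinProb q m w = contestWinProb (fun t _ => p t) m w :=
      ih (by omega) fun t ht => hq t (by omega)
    have hsub : 2 * N - (2 * N - m) = m := by omega
    have hle : ∀ w' : Finset (Fin (2 * N + 1)),
        (∀ s ∈ w', s ≤ (⟨2 * N - m, by omega⟩ : Fin (2 * N + 1))) →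
        contestWinProb q m w' = contestWinProb (fun t _ => p t) m w' := fun w' hw' =>
      ih' fun s hs => by
        have := Fin.le_def.1 (hw' s hs)
        simp only at this
        omega
    have hlt : ∀ s ∈ w, s < (⟨2 * N - m, by omega⟩ : Fin (2 * N + 1)) := fun s hs => by
      have := hw s hs
      rw [Fin.lt_def]
      simp only
      omega
    -- `hq` may assume that later values agree, so equilibrium conditions stated with `q` can be
    -- read with `p`.
    have key := hq ⟨2 * N - m, by omega⟩ (by simp only; omega) w hlt
    simp only [hsub] at key
    simp only [contestWinProb]
    rw [hle w fun s hs => (hlt s hs).le, hle (insert _ w) fun s hs => ?_]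
    -- In a battle that does not matter, the weights `q` and 1 - `q` multiply equal values and drop
    -- out.
    · by_cases heq : contestWinProb (fun t _ => p t) m w =
          contestWinProb (fun t _ => p t) m (insert ⟨2 * N - m, by omega⟩ w)
      · rw [← heq]
        ring
      · rw [key hle heq]
    · rcases Finset.mem_insert.1 hs with rfl | hs
      · exact le_rfl
      · exact (hlt s hs).le

end Contest

/-! ### From equilibrium play to the reduced form -/

namespace TeamContest

variable {N : ℕ}

theorem pA_eq_tullock (C : TeamContest N) (vA vB : Fin (2 * N + 1) → ℝ) (t : Fin (2 * N + 1)) :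
    C.pA vA vB t = tullock (C.r t) (vA t / C.cA t) (vB t / C.cB t) := by
  simp [pA, tullock, (C.cA_pos t).ne', (C.cB_pos t).ne']

theorem pA_mem_Icc (C : TeamContest N) {vA vB : Fin (2 * N + 1) → ℝ} (hA : ∀ t, 0 ≤ vA t)
    (hB : ∀ t, 0 ≤ vB t) (t : Fin (2 * N + 1)) : C.pA vA vB t ∈ Set.Icc 0 1 := by
  rw [pA_eq_tullock]
  exact tullock_mem_Icc (div_nonneg (hA t) (C.cA_pos t).le) (div_nonneg (hB t) (C.cB_pos t).le)

theorem isBattleOutcome_iff_pA (C : TeamContest N) {vA vB : Fin (2 * N + 1) → ℝ}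
    (hA : ∀ t, 0 ≤ vA t) (hB : ∀ t, 0 ≤ vB t) (t : Fin (2 * N + 1)) {V1 V0 p : ℝ} (hV : V0 < V1) :
    IsBattleOutcome (C.r t) (C.cA t) (C.cB t) (vA t) (vB t) V1 V0 p ↔ p = C.pA vA vB t := by
  rw [pA_eq_tullock]
  exact isBattleOutcome_iff (C.r_pos t) (C.r_le_one t) (C.cA_pos t) (C.cB_pos t) (hA t) (hB t) hV

/-- Whatever the equilibrium play of the battles, a team wins the contest with the probability
given by the reduced form. -/
theorem IsContinuation.contestWinProb_eq {C : TeamContest N} {vA vB : Fin (2 * N + 1) → ℝ}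
    (hA : ∀ t, 0 ≤ vA t) (hB : ∀ t, 0 ≤ vB t)
    {q : Fin (2 * N + 1) → Finset (Fin (2 * N + 1)) → ℝ} (hq : C.IsContinuation vA vB q) :
    contestWinProb q (2 * N + 1) ∅ = C.probA vA vB := by
  rw [probA_eq_majorityProb, ← contestWinProb_eq_majorityProb]
  refine contestWinProb_congr le_rfl (fun t _ w hw heq hne => ?_) (by simp)
  have h := hq t w hw
  rw [heq w fun s hs => (hw s hs).le, heq (insert t w) fun s hs => ?_] at h
  -- Monotonicity turns "the two values differ" into V0 < V1.
  · exact (C.isBattleOutcome_iff_pA hA hB t (lt_of_le_of_ne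
      (contestWinProb_mono (C.pA_mem_Icc hA hB) _ (Finset.subset_insert t w)) hne)).1 h
  · rcases Finset.mem_insert.1 hs with rfl | hs
    · exact le_rfl
    · exact (hw s hs).le

-- Reduced-form values decide which battles matter, so no recursive choice is needed: `q` is `pA`
-- there and 1/2, the outcome of zero efforts, elsewhere. By `contestWinProb_congr` its own values
-- are the reduced-form ones.
open Classical in
theorem exists_isContinuation (C : TeamContest N) {vA vB : Fin (2 * N + 1) → ℝ}
    (hA : ∀ t, 0 ≤ vA t) (hB : ∀ t, 0 ≤ vB t) : ∃ q, C.IsContinuation vA vB q := by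
  let V := contestWinProb fun t _ => C.pA vA vB t
  let q : Fin (2 * N + 1) → Finset (Fin (2 * N + 1)) → ℝ := fun t w =>
    if V (2 * N - t) w = V (2 * N - t) (insert t w) then 1 / 2 else C.pA vA vB t
  have hV : ∀ t : Fin (2 * N + 1), ∀ w : Finset (Fin (2 * N + 1)), (∀ s ∈ w, s ≤ t) →
      contestWinProb q (2 * N - t) w = V (2 * N - t) w := by
    intro t w hw
    have hm : 2 * N - (t : ℕ) ≤ 2 * N + 1 := by omega
    refine contestWinProb_congr (p := C.pA vA vB) (q := q) hm
      (fun s _ w' _ _ hne => if_neg hne) fun s hs => ?_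
    have := Fin.le_def.1 (hw s hs)
    omega
  refine ⟨q, fun t w hw => ?_⟩
  rw [hV t w fun s hs => (hw s hs).le, hV t (insert t w) fun s hs => ?_]
  · by_cases h : V (2 * N - t) w = V (2 * N - t) (insert t w)
    · have : q t w = 1 / 2 := if_pos h
      rw [this, h]
      exact isBattleOutcome_half_of_eq (C.cA_pos t) (C.cB_pos t)
    · exact (C.isBattleOutcome_iff_pA hA hB t (lt_of_le_of_ne
        (contestWinProb_mono (C.pA_mem_Icc hA hB) _ (Finset.subset_insert t w)) h)).2 (if_neg h)
  · rcases Finset.mem_insert.1 hs with rfl | hs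
    · exact le_rfl
    · exact (hw s hs).le

theorem exists_isPlay (C : TeamContest N) : ∃ Q, C.IsPlay Q := by
  have h : ∀ vA vB : Fin (2 * N + 1) → ℝ, ∃ q : Fin (2 * N + 1) → Finset (Fin (2 * N + 1)) → ℝ,
      (∀ t, 0 ≤ vA t) → (∀ t, 0 ≤ vB t) → C.IsContinuation vA vB q := by
    intro vA vB
    by_cases hv : (∀ t, 0 ≤ vA t) ∧ ∀ t, 0 ≤ vB t
    · obtain ⟨q, hq⟩ := C.exists_isContinuation hv.1 hv.2
      exact ⟨q, fun _ _ => hq⟩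
    -- An arbitrary value: no play is required after negative prizes.
    · exact ⟨fun _ _ => 0, fun hA hB => absurd ⟨hA, hB⟩ hv⟩
  choose Q hQ using h
  exact ⟨Q, fun vA hvA vB hvB => hQ vA vB hvA.1 hvB.1⟩

theorem IsPlay.isManagersEquilibrium_iff {C : TeamContest N}
    {Q : (Fin (2 * N + 1) → ℝ) → (Fin (2 * N + 1) → ℝ) →
      Fin (2 * N + 1) → Finset (Fin (2 * N + 1)) → ℝ} (hQ : C.IsPlay Q)
    (vA vB : Fin (2 * N + 1) → ℝ) :
    C.IsManagersEquilibrium Q vA vB ↔ C.IsReducedEquilibrium vA vB := by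
  have hwin : ∀ x ∈ prizeDivisions N C.WA, ∀ y ∈ prizeDivisions N C.WB,
      contestWinProb (Q x y) (2 * N + 1) ∅ = C.probA x y := fun x hx y hy =>
    (hQ x hx y hy).contestWinProb_eq hx.1 hy.1
  unfold IsManagersEquilibrium IsReducedEquilibrium IsNash
  refine and_congr_right fun hA => and_congr_right fun hB => and_congr ?_ ?_
  · refine forall₂_congr fun x hx => ?_
    beta_reduce
    rw [hwin x hx vB hB, hwin vA hA vB hB]
  · refine forall₂_congr fun y hy => ?_
    beta_reduce
    rw [hwin vA hA y hy, hwin vA hA vB hB, ← probB_eq_one_sub_probA, ← probB_eq_one_sub_probA]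

end TeamContest

theorem mainTheorem10 (N : ℕ) (C : TeamContest N)
    (hbal : ∀ t, (C.cB t / C.cA t) ^ C.r t = (C.WB / C.WA) ^ C.r t) :
    (∀ vA vB : Fin (2 * N + 1) → ℝ,
      C.IsReducedEquilibrium vA vB ↔
        (∀ t, vA t = C.WA * C.r t / ∑ s, C.r s) ∧ (∀ t, vB t = C.WB * C.r t / ∑ s, C.r s)) ∧
    (∀ vA vB : Fin (2 * N + 1) → ℝ, C.IsReducedEquilibrium vA vB →
      ∀ t, C.pA vA vB t = 1 / 2 ∧ C.pB vA vB t = 1 / 2) ∧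
    (∃ Q, C.IsPlay Q) ∧
    (∀ Q, C.IsPlay Q → ∀ vA vB : Fin (2 * N + 1) → ℝ,
      C.IsManagersEquilibrium Q vA vB ↔
        (∀ t, vA t = C.WA * C.r t / ∑ s, C.r s) ∧ (∀ t, vB t = C.WB * C.r t / ∑ s, C.r s)) := by
  have hiff : ∀ vA vB : Fin (2 * N + 1) → ℝ, C.IsReducedEquilibrium vA vB ↔
      (∀ t, vA t = C.WA * C.r t / ∑ s, C.r s) ∧ (∀ t, vB t = C.WB * C.r t / ∑ s, C.r s) :=
    fun vA vB => (C.isReducedEquilibrium_iff hbal vA vB).trans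
      (and_congr funext_iff funext_iff)
  refine ⟨hiff, fun vA vB h t => ?_, C.exists_isPlay, fun Q hQ vA vB =>
    (hQ.isManagersEquilibrium_iff vA vB).trans (hiff vA vB)⟩
  obtain ⟨rfl, rfl⟩ := (C.isReducedEquilibrium_iff hbal vA vB).1 h
  have hp := C.pA_powerShares hbal t
  refine ⟨hp, ?_⟩
  rw [TeamContest.pB, hp]
  norm_num
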